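/- Fix $N\ge 1$. **Colored permutations.** An $N$-colored permutation of $[n]=\{1,\dots,n\}$ is a word $\pi=\pi_1\cdots\pi_n$ with $\pi_i=|\pi_i|^{\epsilon_i}$, where $|\pi|\colon i\mapsto|\pi_i|$ is a permutation of $[n]$ and $\epsilon_i\in\{0,\dots,N-1\}$ is the color of $\pi_i$. Its letters are ordered by $$1^{N-1}<\dots<n^{N-1}<1^{N-2}<\dots<n^{N-2}<\dots<1^0<\dots<n^0 .$$ Position $i$ is an excedance of $\pi$ if $\pi_i>i^0$, and $\mathrm{exc}(\pi)$ is the number of excedances. Let $\widetilde\pi$ be the word obtained from $\pi$ by replacing $\pi_i$ by $\widetilde{\pi_i}$ at every excedance $i$, where $\widetilde{1^0}<\dots<\widetilde{n^0}$ and these letters are smaller than all letters without a tilde; then $\mathrm{DEX}(\pi)=\{i\in[n-1]:\widetilde\pi_i>\widetilde\pi_{i+1}\}$. The cv-cycle type $\check\lambda(\pi)$ is the multiset containing, for each cycle of $|\pi|$ (fixed points included), the pair (length of the cycle, color vector $\beta\in\mathbb N^{N-1}$), where $\beta_m$ is the number of $i$ in the cycle with $\epsilon_i=m$. Let $\check\lambda=\{(\lambda_1,\beta^1),\dots,(\lambda_k,\beta^k)\}$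 be a multiset of pairs in $\mathbb N\times\mathbb N^{N-1}$, $n=\lambda_1+\dots+\lambda_k$, and $j\ge 0$. A weakly decreasing sequence $s=(s_1\ge\dots\ge s_n)$ of positive integers is $T$-compatible, for $T\subseteq[n-1]$, if $s_i>s_{i+1}$ for all $i\in T$. Let $\mathrm{Com}(\check\lambda,j)$ be the set of pairs $(\pi,s)$ where $\pi$ is an $N$-colored permutation of $[n]$ with $\check\lambda(\pi)=\check\lambda$ and $\mathrm{exc}(\pi)=j$, and $s$ is $\mathrm{DEX}(\pi)$-compatible; put $\mathrm{wt}(\pi,s)=x_{s_1}\cdots x_{s_n}$. Let $$Q_{\check\lambda,j}=\sum_{\pi:\ \check\lambda(\pi)=\check\lambda,\ \mathrm{exc}(\pi)=j}F_{\mathrm{DEX}(\pi),n},\qquad F_{T,n}=\sum_{s\ T\text{-compatible}}x_{s_1}\cdots x_{s_n}.$$ **Ornaments.** Consider the letters $u^m$ (unbarred, of color $m$) and $\overline{u^0}$ (barred, of color $0$) for $u\ge1$ and $0\le m\le N-1$, all of absolute value $u$. A colored necklace is a nonempty word in these letters, taken up to cyclic rotation, which is primitive (not a proper power of another word) and such that,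 cyclically, (1) every barred letter is followed by a letter of smaller or equal absolute value, (2) every unbarred letter of color $0$ is followed by a letter of greater or equal absolute value, and (3) it does not consist of a single barred letter. A colored ornament is a finite multiset $R$ of colored necklaces. Its weight $\mathrm{wt}(R)$ is the product of $x_{|a|}$ over all letters $a$ of all its necklaces (with multiplicity), and its cv-cycle type is the multiset of the pairs (length, color vector) of its necklaces, where the $m$-th entry of the color vector is the number of letters of color $m$, $1\le m\le N-1$. Let $\mathcal R(\check\lambda,j)$ be the set of colored ornaments of cv-cycle type $\check\lambda$ with exactly $j$ barred letters in total. **Theorem.** There is a bijection $f\colon\mathrm{Com}(\check\lambda,j)\to\mathcal R(\check\lambda,j)$ with $\mathrm{wt}(f(\pi,s))=\mathrm{wt}(\pi,s)$ for all $(\pi,s)$. Consequently, as formal power series in $x_1,x_2,\dots$, $$Q_{\check\lambda,j}=\sum_{(\pi,s)\in\mathrm{Com}(\check\lambda,j)}\mathrm{wt}(\pi,s)=\sum_{R\in\mathcal R(\check\lambda,j)}\mathrm{wt}(R).$$ -/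

import Mathlib

open scoped MvPowerSeries.WithPiTopology

namespace ColoredEulerian

noncomputable section

/-! ## Colored permutations

Positions and values `1, …, n` are represented by `Fin n`, colors `0, …, N - 1` by `Fin N`. -/

/-- The ordered alphabet `𝓔` of `N`-colored integers: a letter `k ^ c` is the pair `(c, k)`.
Letters are compared first by color, where a larger color means a smaller letter, and then by `k`:
`1^{N-1} < ⋯ < n^{N-1} < ⋯ < 1^0 < ⋯ < n^0`. -/
abbrev ELetter (N n : ℕ) : Type := (Fin N)ᵒᵈ ×ₗ Fin n

/-- The letter `k ^ c` of `𝓔`. -/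
def eLetter {N n : ℕ} (k : Fin n) (c : Fin N) : ELetter N n := toLex (OrderDual.toDual c, k)

/-- The ordered alphabet `𝓐`: the letters of `𝓔` preceded by the letters with a tilde,
where `Sum.inl k` stands for `k ^ 0` with a tilde. -/
abbrev ALetter (N n : ℕ) : Type := Fin n ⊕ₗ ELetter N n

/-- Elements of the wreath product `C_N ≀ S_n`, seen as words `π` over `𝓔` of length `n` such that
`|π|` is a permutation: the first component is `|π|`, the second one is `i ↦ ε_i`. -/
abbrev ColoredPerm (N n : ℕ) : Type := Equiv.Perm (Fin n) × (Fin n → Fin N)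

/-- The `i`-th letter `π_i = |π_i| ^ ε_i`. -/
def ColoredPerm.letter {N n : ℕ} (π : ColoredPerm N n) (i : Fin n) : ELetter N n :=
  eLetter (π.1 i) (π.2 i)

/-- The excedance set `EXC(π) = {i : π_i > i^0}`. -/
def ColoredPerm.EXC {N n : ℕ} [NeZero N] (π : ColoredPerm N n) : Finset (Fin n) :=
  {i | eLetter i (0 : Fin N) < π.letter i}

/-- The excedance number. -/
def ColoredPerm.exc {N n : ℕ} [NeZero N] (π : ColoredPerm N n) : ℕ := π.EXC.card

/-- The descent set of a word: all positions `i` that have a successor and satisfy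
`w_i > w_{i+1}`. -/
def DES {A : Type*} [LinearOrder A] {n : ℕ} (w : Fin n → A) : Set (Fin n) :=
  {i | ∃ h : (i : ℕ) + 1 < n, w ⟨(i : ℕ) + 1, h⟩ < w i}

/-- The word `π̃`, in which the letters at excedance positions (which have color `0`) get a
tilde. -/
def ColoredPerm.tilde {N n : ℕ} [NeZero N] (π : ColoredPerm N n) (i : Fin n) : ALetter N n :=
  if i ∈ π.EXC then toLex (Sum.inl (π.1 i)) else toLex (Sum.inr (π.letter i))

/-- `DEX(π) = DES(π̃)`. -/
def ColoredPerm.DEX {N n : ℕ} [NeZero N] (π : ColoredPerm N n) : Set (Fin n) := DES π.tilde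

/-- The colors `1, …, N - 1`. -/
abbrev PosColor (N : ℕ) [NeZero N] : Type := {m : Fin N // m ≠ 0}

/-- Color vectors, i.e. elements of `ℕ^{N-1}`. -/
abbrev ColorVector (N : ℕ) [NeZero N] : Type := PosColor N → ℕ

/-- Multisets of pairs `(λ_i, β^i)`. The cv-cycle types are those with `1 ≤ λ_i` and
`|β^i| ≤ λ_i` for all `i`; the other ones are not the cv-cycle type of any object below. -/
abbrev CvType (N : ℕ) [NeZero N] : Type := Multiset (ℕ × ColorVector N)

/-- The number `n = λ_1 + ⋯ + λ_k`. -/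
def CvType.size {N : ℕ} [NeZero N] (lam : CvType N) : ℕ := (lam.map Prod.fst).sum

open Classical in
/-- The underlying sets of the cycles of a permutation (fixed points included). -/
def cycleSets {n : ℕ} (σ : Equiv.Perm (Fin n)) : Finset (Finset (Fin n)) :=
  Finset.univ.image fun i => Finset.univ.filter fun k => σ.SameCycle i k

/-- The cv-cycle type of a colored permutation: every cycle contributes its length and, for every
color `m ≠ 0`, the number of its letters of color `m`. -/
def ColoredPerm.cvType {N n : ℕ} [NeZero N] (π : ColoredPerm N n) : CvType N :=
  (cycleSets π.1).val.map fun C => (C.card, fun m => (C.filter fun i => π.2 i = m.1).card)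

/-! ## Colored Eulerian quasisymmetric functions

All formal power series are in the variables `x_1, x_2, …`, and infinite sums of them converge
coefficientwise (the product topology, with `ℤ` discrete). -/

/-- `s` is a weakly decreasing sequence of positive integers with `s_i > s_{i+1}` for `i ∈ T`. -/
def IsCompatible {n : ℕ} (T : Set (Fin n)) (s : Fin n → ℕ+) : Prop :=
  Antitone s ∧ ∀ i ∈ T, ∀ h : (i : ℕ) + 1 < n, s ⟨(i : ℕ) + 1, h⟩ < s i

/-- The monomial `x_{s_1} ⋯ x_{s_n}`. -/
def seqWeight {n : ℕ} (s : Fin n → ℕ+) : MvPowerSeries ℕ+ ℤ := ∏ i, MvPowerSeries.X (s i)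

/-- The fundamental quasisymmetric function `F_{T,n}`. -/
def fundamentalQSym {n : ℕ} (T : Set (Fin n)) : MvPowerSeries ℕ+ ℤ :=
  ∑' s : {s : Fin n → ℕ+ // IsCompatible T s}, seqWeight s.1

open Classical in
/-- `W_{λ̌,j}`: the colored permutations of cv-cycle type `λ̌` with `j` excedances. -/
def W {N : ℕ} [NeZero N] (lam : CvType N) (j : ℕ) : Finset (ColoredPerm N lam.size) :=
  {π | π.cvType = lam ∧ π.exc = j}

/-- The cv-cycle type colored Eulerian quasisymmetric function `Q_{λ̌,j}`. -/
def Q {N : ℕ} [NeZero N] (lam : CvType N) (j : ℕ) : MvPowerSeries ℕ+ ℤ :=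
  ∑ π ∈ W lam j, fundamentalQSym π.DEX

/-- `Com(λ̌,j)`: the pairs `(π, s)` where `π` has cv-cycle type `λ̌` and `j` excedances and `s` is
`DEX(π)`-compatible. -/
def Com {N : ℕ} [NeZero N] (lam : CvType N) (j : ℕ) : Type :=
  {p : ColoredPerm N lam.size × (Fin lam.size → ℕ+) //
    p.1.cvType = lam ∧ p.1.exc = j ∧ IsCompatible p.1.DEX p.2}

/-- The weight of a pair `(π, s)`. -/
def Com.wt {N : ℕ} [NeZero N] {lam : CvType N} {j : ℕ} (p : Com lam j) : MvPowerSeries ℕ+ ℤ :=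
  seqWeight p.1.2

/-! ## Colored necklaces and ornaments -/

/-- The letters of the alphabet `𝓑`: the unbarred letters `u ^ m` and the barred letters, which
all have color `0`. -/
inductive BLetter (N : ℕ) : Type
  | unbarred (u : ℕ+) (m : Fin N) : BLetter N
  | barred (u : ℕ+) : BLetter N

/-- The absolute value of a letter. -/
def BLetter.abs {N : ℕ} : BLetter N → ℕ+
  | .unbarred u _ => u
  | .barred u => u

/-- The color of a letter. -/
def BLetter.color {N : ℕ} [NeZero N] : BLetter N → Fin N
  | .unbarred _ m => m
  | .barred _ => 0

/-- Whether a letter is barred. -/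
def BLetter.isBarred {N : ℕ} : BLetter N → Bool
  | .unbarred _ _ => false
  | .barred _ => true

/-- A circular word, i.e. an orbit of words under cyclic rotation, is primitive if the size of the
orbit is the length of the word. (The orbit of the empty word has size `1`, so that the empty word
is not primitive.) -/
def IsPrimitive {A : Type*} (c : Cycle A) : Prop :=
  {v : List A | (v : Cycle A) = c}.ncard = c.length

/-- The first two rules for necklaces, for a letter `a` followed by a letter `b`. -/
def NecklaceRule {N : ℕ} [NeZero N] (a b : BLetter N) : Prop :=
  (a.isBarred = true → b.abs ≤ a.abs) ∧
    (a.isBarred = false → a.color = 0 → a.abs ≤ b.abs)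

/-- Colored necklaces. `Cycle.Chain` requires the rule for all cyclically adjacent letters. -/
def Necklace (N : ℕ) [NeZero N] : Type :=
  {c : Cycle (BLetter N) // IsPrimitive c ∧ c.Chain NecklaceRule ∧
    ∀ u : ℕ+, c ≠ (([BLetter.barred u] : List (BLetter N)) : Cycle (BLetter N))}

/-- The length of a necklace and its color vector. -/
def Necklace.cvPair {N : ℕ} [NeZero N] (v : Necklace N) : ℕ × ColorVector N :=
  (v.1.length, fun m => v.1.toMultiset.countP fun a => a.color = m.1)

/-- The weight of a necklace, `x_{|v_1|} ⋯ x_{|v_n|}`. -/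
def Necklace.wt {N : ℕ} [NeZero N] (v : Necklace N) : MvPowerSeries ℕ+ ℤ :=
  (v.1.toMultiset.map fun a => MvPowerSeries.X a.abs).prod

/-- The number of barred letters of a necklace. -/
def Necklace.numBarred {N : ℕ} [NeZero N] (v : Necklace N) : ℕ :=
  v.1.toMultiset.countP fun a => a.isBarred = true

/-- Colored ornaments: finite multisets of colored necklaces. -/
abbrev Ornament (N : ℕ) [NeZero N] : Type := Multiset (Necklace N)

/-- The cv-cycle type of an ornament. -/
def Ornament.cvType {N : ℕ} [NeZero N] (R : Ornament N) : CvType N := R.map Necklace.cvPair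

/-- The number of barred letters of an ornament, with multiplicity. -/
def Ornament.numBarred {N : ℕ} [NeZero N] (R : Ornament N) : ℕ := (R.map Necklace.numBarred).sum

/-- `𝓡(λ̌,j)`: the ornaments of cv-cycle type `λ̌` with exactly `j` barred letters. -/
def Orn {N : ℕ} [NeZero N] (lam : CvType N) (j : ℕ) : Type :=
  {R : Ornament N // R.cvType = lam ∧ R.numBarred = j}

/-- The weight of an ornament: the product of the weights of its necklaces. -/
def Orn.wt {N : ℕ} [NeZero N] {lam : CvType N} {j : ℕ} (R : Orn lam j) : MvPowerSeries ℕ+ ℤ :=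
  (R.1.map Necklace.wt).prod

end

end ColoredEulerian

namespace ColoredEulerian

noncomputable section

open Function

/-! ## Periodic words and primitive circular words -/

section Words

variable {A : Type*}

/-! The bijection is of Gessel–Reutenauer type. Write at position `i` the letter with absolute value
`s i` and the color of `π_i`, barred exactly when `i` is an excedance (`label`), and read these
letters around the cycles of `|π|`.

Order the letters by decreasing absolute value, then barred first, then by decreasing color. Then
`DEX`-compatibility says exactly that the labels weakly increase and that `|π|` increases wherever
they are constant (`isCompatible_iff_isStandard`). For such standard pairs over any linearly ordered
alphabet, reading cycles is a bijection onto multisets of primitive circular words of total length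
`n`. The infinite words read from the positions `1, …, n` are lexicographically sorted, and as a
multiset they are all rotations of the circular words. So the circular words determine the word at
each position, and the inverse permutation is the stable sort of the shifted words
(`IsStandard.eq_of_cycleMultiset_eq`). Sorting the rotations of a given multiset builds a preimage
(`exists_isStandard_of_isPrimitive`).

It remains to match bars with excedances. Monotonicity of `s` gives the necklace rules. Conversely,
the rules make a nonconstant word starting with a barred letter smaller than its shift, and one
starting with an unbarred letter of color 0 larger, so the barred positions of the preimage are its
excedances. -/

/-- The shift of an infinite word. -/
def shift (w : ℕ → A) : ℕ → A := fun k => w (k + 1)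

theorem shift_iterate_apply (m : ℕ) (w : ℕ → A) (k : ℕ) : shift^[m] w k = w (k + m) := by
  induction m generalizing k with
  | zero => rfl
  | succ m ih =>
    rw [iterate_succ_apply']
    change shift^[m] w (k + 1) = _
    rw [ih]
    congr 1
    omega

theorem apply_mod_of_isPeriodicPt {d : ℕ} {w : ℕ → A} (h : IsPeriodicPt shift d w) (k : ℕ) :
    w (k % d) = w k := by
  have := congrFun (h.iterate_mod_apply k) 0
  simpa [shift_iterate_apply] using this

theorem eq_of_map_range_eq {d : ℕ} {w w' : ℕ → A} (hd : 0 < d) (h : IsPeriodicPt shift d w)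
    (h' : IsPeriodicPt shift d w') (e : (List.range d).map w = (List.range d).map w') : w = w' := by
  funext k
  rw [← apply_mod_of_isPeriodicPt h, ← apply_mod_of_isPeriodicPt h']
  exact List.map_inj_left.1 e _ (List.mem_range.2 (Nat.mod_lt _ hd))

theorem rotate_map_range {d : ℕ} {w : ℕ → A} (h : IsPeriodicPt shift d w) (m : ℕ) :
    ((List.range d).map w).rotate m = (List.range d).map (shift^[m] w) := by
  apply List.ext_getElem
  · simp
  · intro k _ _
    simp [List.getElem_rotate, shift_iterate_apply, apply_mod_of_isPeriodicPt h]

theorem setOf_coe_eq_map_range {d : ℕ} {w : ℕ → A} (hd : 0 < d) (h : IsPeriodicPt shift d w) :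
    {v : List A | (v : Cycle A) = ((List.range d).map w : List A)} =
      (fun m => (List.range d).map (shift^[m] w)) '' Set.Iio (minimalPeriod shift w) := by
  ext v
  simp only [Set.mem_ofPred_eq, Set.mem_image, Set.mem_Iio]
  constructor
  · intro hv
    obtain ⟨m, hm⟩ := (Cycle.coe_eq_coe.1 hv).symm
    refine ⟨m % minimalPeriod shift w, Nat.mod_lt _ (h.minimalPeriod_pos hd), ?_⟩
    rw [iterate_mod_minimalPeriod_eq, ← rotate_map_range h, hm]
  · rintro ⟨m, -, rfl⟩
    rw [← rotate_map_range h]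
    exact Cycle.coe_eq_coe.2 (List.IsRotated.symm ⟨m, rfl⟩)

/-- Shifts below the minimal period differ, and already differ on their first `d` letters because
`d` is a period; hence the rotation class has exactly `minimalPeriod shift w` elements. -/
theorem isPrimitive_map_range_iff {d : ℕ} {w : ℕ → A} (hd : 0 < d) (h : IsPeriodicPt shift d w) :
    IsPrimitive (((List.range d).map w : List A) : Cycle A) ↔ minimalPeriod shift w = d := by
  rw [IsPrimitive, setOf_coe_eq_map_range hd h, Set.InjOn.ncard_image]
  · simp [Set.ncard_eq_toFinset_card']
  · intro m hm m' hm' e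
    exact iterate_injOn_Iio_minimalPeriod hm hm'
      (eq_of_map_range_eq hd (h.apply_iterate m) (h.apply_iterate m') e)

/-- The circular word formed by one period of a periodic word. -/
def periodCycle (w : ℕ → A) : Cycle A := ((List.range (minimalPeriod shift w)).map w : List A)

theorem periodCycle_length (w : ℕ → A) : (periodCycle w).length = minimalPeriod shift w := by
  simp [periodCycle]

theorem periodCycle_eq_map (w : ℕ → A) :
    periodCycle w = (periodicOrbit shift w).map fun v => v 0 := by
  simp only [periodCycle, periodicOrbit, Cycle.map_coe, List.map_map]
  congr 2
  funext k
  simp [shift_iterate_apply]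

theorem periodCycle_iterate {w : ℕ → A} (h : w ∈ periodicPts shift) (m : ℕ) :
    periodCycle (shift^[m] w) = periodCycle w := by
  rw [periodCycle_eq_map, periodicOrbit_apply_iterate_eq h, periodCycle_eq_map]

theorem exists_iterate_eq_of_periodCycle_eq {w w' : ℕ → A} (h : w ∈ periodicPts shift)
    (e : periodCycle w = periodCycle w') :
    ∃ m, shift^[m] w = w' := by
  have hp : minimalPeriod shift w = minimalPeriod shift w' := by
    rw [← periodCycle_length, e, periodCycle_length]
  have hw := isPeriodicPt_minimalPeriod shift w
  have hw' := isPeriodicPt_minimalPeriod shift w'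
  have pos := minimalPeriod_pos_of_mem_periodicPts h
  obtain ⟨m, hm⟩ := Cycle.coe_eq_coe.1 e
  refine ⟨m, eq_of_map_range_eq pos (hw.apply_iterate m) (hp ▸ hw') ?_⟩
  rw [← rotate_map_range hw, hm, hp]

theorem isPrimitive_periodCycle {w : ℕ → A} (h : w ∈ periodicPts shift) :
    IsPrimitive (periodCycle w) :=
  (isPrimitive_map_range_iff (minimalPeriod_pos_of_mem_periodicPts h)
    (isPeriodicPt_minimalPeriod shift w)).2 rfl

theorem exists_periodCycle_eq {c : Cycle A} (hc : IsPrimitive c) :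
    ∃ w ∈ periodicPts shift, periodCycle w = c := by
  induction c using Quotient.inductionOn with | _ l => ?_
  change IsPrimitive (l : Cycle A) at hc
  change ∃ w ∈ periodicPts shift, periodCycle w = (l : Cycle A)
  -- The empty word has a rotation class of size 1 but length 0, so it is not primitive and periodic
  -- extension makes sense.
  have hl : l ≠ [] := by
    rintro rfl
    have : {v : List A | (v : Cycle A) = (([] : List A) : Cycle A)} = {[]} := by
      ext v
      simp
    rw [IsPrimitive, this] at hc
    simp at hc
  have pos : 0 < l.length := List.length_pos_iff.2 hl
  let w : ℕ → A := fun k => l[k % l.length]'(Nat.mod_lt _ pos)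
  have hw : IsPeriodicPt shift l.length w := by
    funext k
    simp [shift_iterate_apply, w]
  have hlw : (List.range l.length).map w = l := by
    apply List.ext_getElem
    · simp
    · intro k h1 h2
      simp [w, Nat.mod_eq_of_lt h2]
  have hmin : minimalPeriod shift w = l.length :=
    (isPrimitive_map_range_iff pos hw).1 (by rwa [hlw])
  exact ⟨w, mk_mem_periodicPts pos hw, by rw [periodCycle, hmin, hlw]⟩

theorem chain_periodCycle_iff {r : A → A → Prop} {w : ℕ → A} (h : w ∈ periodicPts shift) :
    (periodCycle w).Chain r ↔ ∀ k, r (w k) (w (k + 1)) := by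
  rw [periodCycle_eq_map, Cycle.chain_map, periodicOrbit_chain' _ h]
  simp [shift_iterate_apply]

/-- The periodic words whose period is a given circular word. -/
def wordsOf (c : Cycle A) : Set (ℕ → A) := {w | w ∈ periodicPts shift ∧ periodCycle w = c}

theorem wordsOf_periodCycle {w : ℕ → A} (h : w ∈ periodicPts shift) :
    wordsOf (periodCycle w) = (fun m => shift^[m] w) '' Set.Iio (minimalPeriod shift w) := by
  ext v
  simp only [wordsOf, Set.mem_ofPred_eq, Set.mem_image, Set.mem_Iio]
  constructor
  · rintro ⟨hv, e⟩
    obtain ⟨m, rfl⟩ := exists_iterate_eq_of_periodCycle_eq h e.symm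
    exact ⟨m % minimalPeriod shift w, Nat.mod_lt _ (minimalPeriod_pos_of_mem_periodicPts h),
      iterate_mod_minimalPeriod_eq⟩
  · rintro ⟨m, -, rfl⟩
    refine ⟨?_, periodCycle_iterate h m⟩
    obtain ⟨d, hd, hw⟩ := h
    exact mk_mem_periodicPts hd (hw.apply_iterate m)

theorem finite_wordsOf (c : Cycle A) : (wordsOf c).Finite := by
  by_cases h : ∃ w, w ∈ wordsOf c
  · obtain ⟨w, hw, rfl⟩ := h
    rw [wordsOf_periodCycle hw]
    exact (Set.finite_Iio _).image _
  · rw [Set.not_nonempty_iff_eq_empty.1 h]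
    exact Set.finite_empty

theorem ncard_wordsOf {c : Cycle A} (hc : IsPrimitive c) : (wordsOf c).ncard = c.length := by
  obtain ⟨w, hw, rfl⟩ := exists_periodCycle_eq hc
  rw [wordsOf_periodCycle hw, iterate_injOn_Iio_minimalPeriod.ncard_image, periodCycle_length]
  simp [Set.ncard_eq_toFinset_card']

theorem bijOn_shift_wordsOf (c : Cycle A) : Set.BijOn shift (wordsOf c) (wordsOf c) := by
  have hmaps : Set.MapsTo shift (wordsOf c) (wordsOf c) := fun w hw =>
    ⟨(bijOn_periodicPts shift).mapsTo hw.1, (periodCycle_iterate hw.1 1).trans hw.2⟩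
  have hinj : Set.InjOn shift (wordsOf c) :=
    (bijOn_periodicPts shift).injOn.mono fun w hw => hw.1
  refine ⟨hmaps, hinj, fun w hw => ?_⟩
  obtain ⟨v, hv, rfl⟩ := (bijOn_periodicPts shift).surjOn hw.1
  exact ⟨v, ⟨hv, (periodCycle_iterate hv 1).symm.trans hw.2⟩, rfl⟩

open Classical in
/-- The multiset of all words whose cycle belongs to a given multiset of circular words. -/
def wordMultiset (R : Multiset (Cycle A)) : Multiset (ℕ → A) :=
  R.bind fun c => (finite_wordsOf c).toFinset.val

open Classical in
theorem count_wordMultiset (R : Multiset (Cycle A)) (w : ℕ → A) :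
    (wordMultiset R).count w =
      if w ∈ periodicPts shift then R.count (periodCycle w) else 0 := by
  induction R using Multiset.induction_on with
  | empty => simp [wordMultiset]
  | cons c R ih =>
    have : wordMultiset (c ::ₘ R) = (finite_wordsOf c).toFinset.val + wordMultiset R := by
      simp [wordMultiset]
    rw [this, Multiset.count_add, ih, Multiset.count_eq_of_nodup (Finset.nodup _)]
    simp only [Finset.mem_val, Set.Finite.mem_toFinset, wordsOf, Set.mem_ofPred_eq]
    by_cases h : w ∈ periodicPts shift
    · simp [h, Multiset.count_cons, add_comm]
    · simp [h]

theorem card_wordMultiset {R : Multiset (Cycle A)} (hR : ∀ c ∈ R, IsPrimitive c) :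
    (wordMultiset R).card = (R.map Cycle.length).sum := by
  rw [wordMultiset, Multiset.card_bind]
  congr 1
  refine Multiset.map_congr rfl fun c hc => ?_
  rw [← ncard_wordsOf (hR c hc), Set.ncard_eq_toFinset_card _ (finite_wordsOf c)]
  rfl

/-- The shift permutes the rotations of each circular word. This invariance is what lets sorted
words and sorted shifted words be matched in the inverse construction. -/
theorem map_shift_wordMultiset (R : Multiset (Cycle A)) :
    (wordMultiset R).map shift = wordMultiset R := by
  classical
  rw [wordMultiset, Multiset.map_bind]
  congr 1
  funext c
  have h := bijOn_shift_wordsOf c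
  rw [← Finset.image_val_of_injOn (by simpa using h.injOn)]
  congr 1
  apply Finset.coe_injective
  simpa using h.image_eq

theorem wordMultiset_injective {R R' : Multiset (Cycle A)} (hR : ∀ c ∈ R, IsPrimitive c)
    (hR' : ∀ c ∈ R', IsPrimitive c) (e : wordMultiset R = wordMultiset R') : R = R' := by
  classical
  ext c
  by_cases hc : IsPrimitive c
  · obtain ⟨w, hw, rfl⟩ := exists_periodCycle_eq hc
    have := congrArg (Multiset.count w) e
    simpa [count_wordMultiset, hw] using this
  · rw [Multiset.count_eq_zero_of_notMem fun h => hc (hR c h),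
      Multiset.count_eq_zero_of_notMem fun h => hc (hR' c h)]

end Words

/-! ## Multisets indexed by the cycles of a permutation -/

section Orbits

variable {n : ℕ} {β : Type*}

open Classical in
/-- The multiset of the values of a function at one representative of each cycle of `σ`. -/
def orbitMultiset (σ : Equiv.Perm (Fin n)) (g : Fin n → β) : Multiset β :=
  (Finset.univ : Finset (Quotient (Equiv.Perm.SameCycle.setoid σ))).val.map fun q => g q.out

open Classical in
/-- The cycle of `σ` containing `i`. -/
def cycleSet (σ : Equiv.Perm (Fin n)) (i : Fin n) : Finset (Fin n) :=
  Finset.univ.filter fun k => σ.SameCycle i k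

theorem mem_cycleSet {σ : Equiv.Perm (Fin n)} {i k : Fin n} :
    k ∈ cycleSet σ i ↔ σ.SameCycle i k := by
  simp [cycleSet]

theorem cycleSet_eq_iff {σ : Equiv.Perm (Fin n)} {i k : Fin n} :
    cycleSet σ i = cycleSet σ k ↔ σ.SameCycle i k := by
  constructor
  · intro h
    have : k ∈ cycleSet σ k := mem_cycleSet.2 (Equiv.Perm.SameCycle.refl σ k)
    rwa [← h, mem_cycleSet] at this
  · intro h
    ext j
    simp only [mem_cycleSet]
    exact ⟨fun hj => h.symm.trans hj, fun hj => h.trans hj⟩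

theorem sameCycle_out (σ : Equiv.Perm (Fin n)) (i : Fin n) :
    σ.SameCycle (Quotient.mk (Equiv.Perm.SameCycle.setoid σ) i).out i :=
  Quotient.exact (s := Equiv.Perm.SameCycle.setoid σ) (Quotient.out_eq _)

theorem map_orbitMultiset {γ : Type*} (σ : Equiv.Perm (Fin n)) (g : Fin n → β) (h : β → γ) :
    (orbitMultiset σ g).map h = orbitMultiset σ fun i => h (g i) := by
  simp [orbitMultiset]

theorem mem_orbitMultiset {σ : Equiv.Perm (Fin n)} {g : Fin n → β} {b : β}
    (h : b ∈ orbitMultiset σ g) : ∃ i, g i = b := by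
  obtain ⟨q, -, hq⟩ := Multiset.mem_map.1 h
  exact ⟨_, hq⟩

/-- Distinct cycles have distinct underlying sets, so passing to a `Finset` of sets loses no
multiplicity. -/
theorem cycleSets_val (σ : Equiv.Perm (Fin n)) :
    (cycleSets σ).val = orbitMultiset σ (cycleSet σ) := by
  classical
  have hinj : Injective fun q : Quotient (Equiv.Perm.SameCycle.setoid σ) => cycleSet σ q.out := by
    intro q q' h
    rw [← q.out_eq, ← q'.out_eq]
    exact Quotient.sound (s := Equiv.Perm.SameCycle.setoid σ) (cycleSet_eq_iff.1 h)
  rw [orbitMultiset, ← Finset.image_val_of_injOn hinj.injOn]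
  congr 1
  ext C
  simp only [cycleSets, Finset.mem_image, Finset.mem_univ, true_and]
  constructor
  · rintro ⟨i, rfl⟩
    exact ⟨Quotient.mk _ i, cycleSet_eq_iff.2 (sameCycle_out σ i)⟩
  · rintro ⟨q, rfl⟩
    exact ⟨q.out, rfl⟩

theorem prod_orbitMultiset {M : Type*} [CommMonoid M] (σ : Equiv.Perm (Fin n)) (h : Fin n → M) :
    (orbitMultiset σ fun i => ∏ j ∈ cycleSet σ i, h j).prod = ∏ j, h j := by
  classical
  rw [← Finset.prod_fiberwise (g := fun j => Quotient.mk (Equiv.Perm.SameCycle.setoid σ) j)]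
  change ∏ q : Quotient (Equiv.Perm.SameCycle.setoid σ), ∏ j ∈ cycleSet σ q.out, h j = _
  refine Finset.prod_congr rfl fun q _ => Finset.prod_congr ?_ fun _ _ => rfl
  ext j
  simp only [mem_cycleSet, Finset.mem_filter, Finset.mem_univ, true_and]
  rw [eq_comm]
  nth_rw 2 [← q.out_eq]
  exact Quotient.eq (r := Equiv.Perm.SameCycle.setoid σ).symm

theorem sum_orbitMultiset {M : Type*} [AddCommMonoid M] (σ : Equiv.Perm (Fin n)) (h : Fin n → M) :
    (orbitMultiset σ fun i => ∑ j ∈ cycleSet σ i, h j).sum = ∑ j, h j :=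
  prod_orbitMultiset (M := Multiplicative M) σ h

end Orbits

/-! ## The Gessel–Reutenauer correspondence -/

section GesselReutenauer

variable {A : Type*} {n : ℕ}

/-- The word read off when following `σ` from `i`. -/
def walk (σ : Equiv.Perm (Fin n)) (a : Fin n → A) (i : Fin n) : ℕ → A := fun k => a ((σ ^ k) i)

theorem shift_iterate_walk (σ : Equiv.Perm (Fin n)) (a : Fin n → A) (m : ℕ) (i : Fin n) :
    shift^[m] (walk σ a i) = walk σ a ((σ ^ m) i) := by
  funext k
  simp [shift_iterate_apply, walk, pow_add]

theorem shift_walk (σ : Equiv.Perm (Fin n)) (a : Fin n → A) (i : Fin n) :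
    shift (walk σ a i) = walk σ a (σ i) :=
  shift_iterate_walk σ a 1 i

theorem walk_mem_periodicPts (σ : Equiv.Perm (Fin n)) (a : Fin n → A) (i : Fin n) :
    walk σ a i ∈ periodicPts shift :=
  mk_mem_periodicPts (orderOf_pos σ) <| by
    rw [IsPeriodicPt, IsFixedPt, shift_iterate_walk, pow_orderOf_eq_one, Equiv.Perm.one_apply]

theorem periodCycle_walk_eq {σ : Equiv.Perm (Fin n)} {i j : Fin n} (a : Fin n → A)
    (h : σ.SameCycle i j) : periodCycle (walk σ a i) = periodCycle (walk σ a j) := by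
  obtain ⟨m, rfl⟩ := h.exists_nat_pow_eq
  rw [← shift_iterate_walk, periodCycle_iterate (walk_mem_periodicPts σ a i)]

/-- The multiset of circular words read off from the cycles of `σ`. -/
def cycleMultiset (σ : Equiv.Perm (Fin n)) (a : Fin n → A) : Multiset (Cycle A) :=
  orbitMultiset σ fun i => periodCycle (walk σ a i)

theorem isPrimitive_of_mem_cycleMultiset {σ : Equiv.Perm (Fin n)} {a : Fin n → A} {c : Cycle A}
    (hc : c ∈ cycleMultiset σ a) :
    IsPrimitive c := by
  obtain ⟨i, rfl⟩ := mem_orbitMultiset hc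
  exact isPrimitive_periodCycle (walk_mem_periodicPts σ a i)

theorem periodCycle_walk_mem_cycleMultiset (σ : Equiv.Perm (Fin n)) (a : Fin n → A) (i : Fin n) :
    periodCycle (walk σ a i) ∈ cycleMultiset σ a := by
  classical
  rw [periodCycle_walk_eq a (sameCycle_out σ i).symm]
  unfold cycleMultiset orbitMultiset
  exact Multiset.mem_map.2 ⟨_, Finset.mem_univ_val _, rfl⟩

variable [LinearOrder A]

/-- The pairs of a permutation and a weakly increasing word such that the permutation increases
where the word is constant. -/
def IsStandard (σ : Equiv.Perm (Fin n)) (a : Fin n → A) : Prop :=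
  Monotone fun i => (toLex (a i, σ i) : A ×ₗ Fin n)

variable {σ : Equiv.Perm (Fin n)} {a : Fin n → A}

theorem isStandard_iff :
    IsStandard σ a ↔ ∀ i j, i < j → a i < a j ∨ a i = a j ∧ σ i < σ j := by
  constructor
  · intro h i j hij
    have := Prod.Lex.toLex_le_toLex.1 (h hij.le)
    refine this.imp id fun ⟨e, hle⟩ => ⟨e, hle.lt_of_ne fun e' => hij.ne (σ.injective e')⟩
  · intro h i j hij
    rcases hij.eq_or_lt with rfl | hij
    · exact le_rfl
    · exact Prod.Lex.toLex_le_toLex.2 ((h i j hij).imp id fun h => ⟨h.1, h.2.le⟩)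

/-- While two walks read the same letters, each step of `σ` preserves the order of the two
positions. -/
theorem IsStandard.pow_lt_pow (h : IsStandard σ a) {i j : Fin n} (hij : i < j) (k : ℕ)
    (hk : ∀ m < k, walk σ a i m = walk σ a j m) : (σ ^ k) i < (σ ^ k) j := by
  induction k with
  | zero => simpa using hij
  | succ k ih =>
    have hlt := ih fun m hm => hk m (hm.trans k.lt_succ_self)
    have heq : a ((σ ^ k) i) = a ((σ ^ k) j) := hk k k.lt_succ_self
    rw [pow_succ', Equiv.Perm.mul_apply, Equiv.Perm.mul_apply]
    rcases isStandard_iff.1 h _ _ hlt with h' | h'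
    · exact absurd heq h'.ne
    · exact h'.2

theorem IsStandard.monotone_walk (h : IsStandard σ a) :
    Monotone fun i => toLex (walk σ a i) := by
  intro i j hij
  rcases hij.eq_or_lt with rfl | hij
  · exact le_rfl
  by_contra! hlt
  obtain ⟨k, hk, hk'⟩ := hlt
  have := h.pow_lt_pow hij k fun m hm => (hk m hm).symm
  rcases isStandard_iff.1 h _ _ this with h' | h'
  · exact lt_asymm h' hk'
  · exact hk'.ne' h'.1

/-- If `i < σ^d i` and both positions read the same word, then `i < σ^d i < σ^(2d) i < ⋯` never
stops, which is impossible in `Fin n`. So the word around a cycle is never a proper power. -/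
theorem IsStandard.eq_of_walk_eq (h : IsStandard σ a) {i j : Fin n} (hc : σ.SameCycle i j)
    (e : walk σ a i = walk σ a j) : i = j := by
  by_contra hne
  wlog hij : i < j generalizing i j
  · exact this hc.symm e.symm (Ne.symm hne) ((not_lt.1 hij).lt_of_ne (Ne.symm hne))
  obtain ⟨d, rfl⟩ := hc.exists_nat_pow_eq
  have hmono : StrictMono fun m : ℕ => (σ ^ (d * m)) i := by
    refine strictMono_nat_of_lt_succ fun m => ?_
    have := h.pow_lt_pow hij (d * m) fun k _ => congrFun e k
    rwa [← Equiv.Perm.mul_apply, ← pow_add, ← Nat.mul_succ] at this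
  exact not_injective_infinite_finite _ hmono.injective

theorem IsStandard.minimalPeriod_walk (h : IsStandard σ a) (i : Fin n) :
    minimalPeriod shift (walk σ a i) = minimalPeriod σ i := by
  refine minimalPeriod_eq_minimalPeriod_iff.2 fun m => ?_
  rw [IsPeriodicPt, IsFixedPt, IsPeriodicPt, IsFixedPt, shift_iterate_walk,
    Equiv.Perm.iterate_eq_pow]
  refine ⟨fun e => ?_, fun e => by rw [e]⟩
  exact (h.eq_of_walk_eq ⟨m, by simp⟩ e.symm).symm

theorem IsStandard.toMultiset_periodCycle_walk (h : IsStandard σ a) (i : Fin n) :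
    (periodCycle (walk σ a i)).toMultiset = (cycleSet σ i).val.map a := by
  classical
  have hset : cycleSet σ i = (Finset.range (minimalPeriod σ i)).image fun k => σ^[k] i := by
    ext j
    simp only [mem_cycleSet, Finset.mem_image, Finset.mem_range]
    constructor
    · intro hj
      obtain ⟨m, rfl⟩ := hj.exists_nat_pow_eq
      refine ⟨m % minimalPeriod σ i, Nat.mod_lt _ ?_, ?_⟩
      · rw [← h.minimalPeriod_walk]
        exact minimalPeriod_pos_of_mem_periodicPts (walk_mem_periodicPts σ a i)
      · rw [iterate_mod_minimalPeriod_eq, Equiv.Perm.iterate_eq_pow]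
    · rintro ⟨k, -, rfl⟩
      rw [Equiv.Perm.iterate_eq_pow]
      exact ⟨k, by simp⟩
  rw [hset, Finset.image_val_of_injOn, Multiset.map_map, periodCycle, h.minimalPeriod_walk]
  · rw [Cycle.coe_toMultiset, ← Multiset.map_coe]
    refine Multiset.map_congr rfl fun k _ => ?_
    simp [walk, Equiv.Perm.iterate_eq_pow]
  · simpa using iterate_injOn_Iio_minimalPeriod (f := σ) (x := i)

/-- Each cycle whose circular word is that of `w` has exactly one position reading `w`: one exists
by moving along the cycle, and `IsStandard.eq_of_walk_eq` makes it unique. -/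
theorem IsStandard.wordMultiset_cycleMultiset (h : IsStandard σ a) :
    wordMultiset (cycleMultiset σ a) = Finset.univ.val.map (walk σ a) := by
  classical
  ext w
  rw [count_wordMultiset]
  split_ifs with hw
  · rw [cycleMultiset, orbitMultiset, Multiset.count_map, Multiset.count_map, ← Finset.filter_val,
      ← Finset.filter_val]
    symm
    refine Finset.card_bij (fun i _ => Quotient.mk (Equiv.Perm.SameCycle.setoid σ) i) ?_ ?_ ?_
    · intro i hi
      simp only [Finset.mem_filter, Finset.mem_univ, true_and] at hi ⊢
      rw [hi]
      exact (periodCycle_walk_eq a (sameCycle_out σ i)).symm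
    · intro i hi j hj e
      simp only [Finset.mem_filter, Finset.mem_univ, true_and] at hi hj
      exact h.eq_of_walk_eq (Quotient.exact (s := Equiv.Perm.SameCycle.setoid σ) e)
        (hi.symm.trans hj)
    · intro q hq
      simp only [Finset.mem_filter, Finset.mem_univ, true_and] at hq
      obtain ⟨m, hm⟩ := exists_iterate_eq_of_periodCycle_eq (walk_mem_periodicPts σ a q.out) hq.symm
      rw [shift_iterate_walk] at hm
      refine ⟨(σ ^ m) q.out, by simpa using hm.symm, ?_⟩
      rw [← Quotient.out_eq q]
      refine Quotient.sound (s := Equiv.Perm.SameCycle.setoid σ) ?_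
      rw [Quotient.out_eq q]
      exact Equiv.Perm.SameCycle.symm ⟨m, by simp⟩
  · symm
    refine Multiset.count_eq_zero_of_notMem fun hmem => hw ?_
    obtain ⟨i, -, rfl⟩ := Multiset.mem_map.1 hmem
    exact walk_mem_periodicPts σ a i

theorem eq_of_monotone_of_map_univ_eq {α : Type*} [PartialOrder α] {f g : Fin n → α}
    (hf : Monotone f) (hg : Monotone g)
    (e : (Finset.univ : Finset (Fin n)).val.map f = Finset.univ.val.map g) : f = g := by
  apply List.ofFn_injective
  refine List.Perm.eq_of_sortedLE hf.sortedLE_ofFn hg.sortedLE_ofFn (Multiset.coe_eq_coe.1 ?_)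
  simpa [Fin.univ_val_map] using e

theorem IsStandard.inv_eq_sort (h : IsStandard σ a) :
    σ⁻¹ = Tuple.sort fun i => toLex (shift (walk σ a i)) := by
  have hw : (fun i => toLex (shift (walk σ a i))) ∘ ⇑σ⁻¹ = fun i => toLex (walk σ a i) := by
    funext i
    simp [shift_walk]
  refine Tuple.eq_sort_iff.2 ⟨hw ▸ h.monotone_walk, fun i j hij e => ?_⟩
  have e' : walk σ a i = walk σ a j := by
    simpa [shift_walk] using e
  -- As a nonnegative power of `σ`, the inverse also preserves the order of positions reading equal
  -- words; this is the stability of the sort.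
  have hinv : σ⁻¹ = σ ^ (orderOf σ - 1) := by
    rw [inv_eq_iff_mul_eq_one, ← pow_succ', Nat.sub_add_cancel (orderOf_pos σ), pow_orderOf_eq_one]
  rw [hinv]
  exact h.pow_lt_pow hij _ fun m _ => congrFun e' m

theorem IsStandard.eq_of_cycleMultiset_eq {σ' : Equiv.Perm (Fin n)} {a' : Fin n → A}
    (h : IsStandard σ a) (h' : IsStandard σ' a') (e : cycleMultiset σ a = cycleMultiset σ' a') :
    σ = σ' ∧ a = a' := by
  have hm := congrArg wordMultiset e
  rw [h.wordMultiset_cycleMultiset, h'.wordMultiset_cycleMultiset] at hm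
  have hw : (fun i => toLex (walk σ a i)) = fun i => toLex (walk σ' a' i) :=
    eq_of_monotone_of_map_univ_eq h.monotone_walk h'.monotone_walk hm
  have hw' : ∀ i, walk σ a i = walk σ' a' i := fun i => congrFun hw i
  refine ⟨?_, funext fun i => congrFun (hw' i) 0⟩
  rw [← inv_inj, h.inv_eq_sort, h'.inv_eq_sort]
  simp only [hw']

theorem exists_isStandard_of_isPrimitive {R : Multiset (Cycle A)} (hR : ∀ c ∈ R, IsPrimitive c)
    (hn : (R.map Cycle.length).sum = n) :
    ∃ (σ : Equiv.Perm (Fin n)) (a : Fin n → A), IsStandard σ a ∧ cycleMultiset σ a = R := by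
  obtain ⟨f, hf⟩ : ∃ f : Fin n → ℕ → A, Finset.univ.val.map f = wordMultiset R := by
    obtain ⟨l, hl⟩ := Quot.exists_rep (wordMultiset R)
    change (l : Multiset (ℕ → A)) = _ at hl
    have hlen : l.length = n := by
      rw [← hn, ← card_wordMultiset hR, ← hl, Multiset.coe_card]
    subst hlen
    exact ⟨l.get, by rw [Fin.univ_val_map, List.ofFn_get, hl]⟩
  let s := Tuple.sort fun i => toLex (f i)
  let W : Fin n → Lex (ℕ → A) := (fun i => toLex (f i)) ∘ s
  have hWmono : Monotone W := Tuple.monotone_sort fun i => toLex (f i)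
  have hW : Finset.univ.val.map (fun i => ofLex (W i)) = wordMultiset R := by
    rw [← hf]
    nth_rw 2 [← Multiset.map_univ_val_equiv s]
    rw [Multiset.map_map]
    rfl
  let g : Fin n → Lex (ℕ → A) := fun i => toLex (shift (ofLex (W i)))
  have hg : Finset.univ.val.map g = Finset.univ.val.map W := by
    have := map_shift_wordMultiset R
    rw [← hW, Multiset.map_map] at this
    exact this
  -- The required permutation is `τ⁻¹`: it sends a position to one whose word is the shifted word,
  -- and stability of the sort pairs equal words in order.
  let τ := Tuple.sort g
  have hgτ : g ∘ τ = W := by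
    refine eq_of_monotone_of_map_univ_eq (Tuple.monotone_sort g) hWmono ?_
    rw [← Multiset.map_map, Multiset.map_univ_val_equiv, hg]
  have hstep : ∀ i, W (τ⁻¹ i) = g i := fun i => by
    rw [← hgτ]
    simp
  let a : Fin n → A := fun i => ofLex (W i) 0
  have hwalk : ∀ i, walk τ⁻¹ a i = ofLex (W i) := by
    intro i
    funext k
    induction k generalizing i with
    | zero => rfl
    | succ k ih =>
      have : walk τ⁻¹ a i (k + 1) = walk τ⁻¹ a (τ⁻¹ i) k := by
        simp only [walk, pow_succ, Equiv.Perm.mul_apply]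
      rw [this, ih, hstep]
      rfl
  have hstd : IsStandard τ⁻¹ a := by
    refine isStandard_iff.2 fun i j hij => ?_
    have hle : W i ≤ W j := hWmono hij.le
    have hle0 : a i ≤ a j := Pi.apply_le_of_toLex hle (by simp)
    refine hle0.lt_or_eq.imp id fun e => ⟨e, ?_⟩
    -- After equal first letters, the comparison of two words is that of their shifts. Distinct
    -- shifts are ordered by `W`; equal ones by stability of `τ`.
    have hgle : g i ≤ g j := by
      by_contra! hlt
      obtain ⟨k, hk, hk'⟩ := hlt
      refine absurd hle (not_le.2 ⟨k + 1, fun m hm => ?_, hk'⟩)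
      cases m with
      | zero => exact e.symm
      | succ m => exact hk m (Nat.lt_of_succ_lt_succ hm)
    rcases hgle.lt_or_eq with hlt | heq
    · rw [← hstep, ← hstep] at hlt
      exact hWmono.reflect_lt hlt
    · by_contra! hge
      have hlt : τ⁻¹ j < τ⁻¹ i := hge.lt_of_ne fun e' => hij.ne (τ⁻¹.injective e').symm
      have := (Tuple.eq_sort_iff.1 (rfl : τ = Tuple.sort g)).2 _ _ hlt (by simpa using heq.symm)
      exact lt_asymm hij (by simpa using this)
  refine ⟨τ⁻¹, a, hstd, ?_⟩
  refine wordMultiset_injective (fun c hc => isPrimitive_of_mem_cycleMultiset hc) hR ?_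
  rw [hstd.wordMultiset_cycleMultiset, ← hW]
  exact Multiset.map_congr rfl fun i _ => hwalk i

end GesselReutenauer

/-! ## The ordered alphabet of necklace letters -/

section Letters

variable {N : ℕ}

/-- The rank of a letter among the letters with the same absolute value: the barred letter comes
first, then the unbarred ones by decreasing color. -/
def BLetter.rank : BLetter N → WithBot (Fin N)ᵒᵈ
  | .unbarred _ m => (OrderDual.toDual m : (Fin N)ᵒᵈ)
  | .barred _ => ⊥

/-- The sorting key of a letter: larger absolute values come first. -/
def BLetter.key (a : BLetter N) : ℕ+ᵒᵈ ×ₗ WithBot (Fin N)ᵒᵈ :=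
  toLex (OrderDual.toDual a.abs, a.rank)

theorem BLetter.key_injective : Injective (BLetter.key (N := N)) := by
  intro a b h
  have h' := Prod.ext_iff.1 (toLex.injective h)
  cases a <;> cases b <;> simp_all [BLetter.abs, BLetter.rank]

instance : LinearOrder (BLetter N) := LinearOrder.lift' BLetter.key BLetter.key_injective

theorem BLetter.lt_iff {a b : BLetter N} :
    a < b ↔ b.abs < a.abs ∨ a.abs = b.abs ∧ a.rank < b.rank := by
  change a.key < b.key ↔ _
  simp [BLetter.key, Prod.Lex.toLex_lt_toLex]

theorem BLetter.lt_of_isBarred {a b : BLetter N} (ha : a.isBarred = true) (hab : b.abs ≤ a.abs)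
    (hne : b ≠ a) : a < b := by
  rw [BLetter.lt_iff]
  refine hab.lt_or_eq.imp id fun e => ⟨e.symm, ?_⟩
  cases a <;> cases b <;> simp_all [BLetter.abs, BLetter.isBarred, BLetter.rank]

variable [NeZero N]

theorem BLetter.ext {a b : BLetter N} (h1 : a.isBarred = b.isBarred) (h2 : a.abs = b.abs)
    (h3 : a.color = b.color) : a = b := by
  cases a <;> cases b <;> simp_all [BLetter.abs, BLetter.isBarred, BLetter.color]

theorem BLetter.lt_of_color_eq_zero {a b : BLetter N} (ha : a.isBarred = false)
    (hc : a.color = 0) (hab : a.abs ≤ b.abs) (hne : b ≠ a) : b < a := by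
  rw [BLetter.lt_iff]
  refine hab.lt_or_eq.imp id fun e => ⟨e.symm, ?_⟩
  cases a with
  | barred u => simp [BLetter.isBarred] at ha
  | unbarred u m =>
    change m = 0 at hc
    subst hc
    cases b with
    | barred v => exact WithBot.bot_lt_coe _
    | unbarred v m =>
      refine WithBot.coe_lt_coe.2 (OrderDual.toDual_lt_toDual.2 (Fin.pos_iff_ne_zero.2 ?_))
      rintro rfl
      exact hne (congrArg (BLetter.unbarred · 0) e.symm)

theorem exists_first_change {A : Type*} {w : ℕ → A} (hne : shift w ≠ w) :
    ∃ k, (∀ m ≤ k, w m = w 0) ∧ w (k + 1) ≠ w k := by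
  classical
  have hex : ∃ k, w (k + 1) ≠ w k := by
    by_contra! h
    exact hne (funext h)
  refine ⟨Nat.find hex, fun m => ?_, Nat.find_spec hex⟩
  induction m with
  | zero => simp
  | succ m ih =>
    intro hm
    rw [← ih (by omega)]
    exact not_not.1 (Nat.find_min hex (by omega))

/-- A word and its shift agree until the initial constant run ends, and there the necklace rule for
the repeated first letter decides the comparison. -/
theorem lt_shift_of_isBarred {w : ℕ → BLetter N} (hrule : ∀ k, NecklaceRule (w k) (w (k + 1)))
    (hne : shift w ≠ w) (h0 : (w 0).isBarred = true) : toLex w < toLex (shift w) := by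
  obtain ⟨k, hconst, hk⟩ := exists_first_change hne
  refine ⟨k, fun m hm => (hconst m hm.le).trans (hconst (m + 1) hm).symm, ?_⟩
  have hb : (w k).isBarred = true := by rw [hconst _ le_rfl, h0]
  exact BLetter.lt_of_isBarred hb ((hrule _).1 hb) hk

theorem shift_lt_of_color_eq_zero {w : ℕ → BLetter N}
    (hrule : ∀ k, NecklaceRule (w k) (w (k + 1))) (hne : shift w ≠ w)
    (h0 : (w 0).isBarred = false) (hc : (w 0).color = 0) : toLex (shift w) < toLex w := by
  obtain ⟨k, hconst, hk⟩ := exists_first_change hne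
  refine ⟨k, fun m hm => (hconst (m + 1) hm).trans (hconst m hm.le).symm, ?_⟩
  have hb : (w k).isBarred = false := by rw [hconst _ le_rfl, h0]
  have hc' : (w k).color = 0 := by rw [hconst _ le_rfl, hc]
  exact BLetter.lt_of_color_eq_zero hb hc' ((hrule _).2 hb hc') hk

end Letters

/-! ## Compatible sequences as standard words -/

section Labels

variable {N n : ℕ} [NeZero N]

theorem ColoredPerm.mem_EXC {π : ColoredPerm N n} {i : Fin n} :
    i ∈ π.EXC ↔ π.2 i = 0 ∧ i < π.1 i := by
  -- Color 0 is the largest in the letter order, so an excedance cannot arise from the color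
  -- comparison.
  have h : ¬ OrderDual.toDual (0 : Fin N) < OrderDual.toDual (π.2 i) :=
    not_lt.2 (OrderDual.toDual_le_toDual.2 (Fin.zero_le _))
  simp only [ColoredPerm.EXC, ColoredPerm.letter, eLetter, Prod.Lex.toLex_lt_toLex, h, false_or,
    Finset.mem_filter, Finset.mem_univ, true_and, OrderDual.toDual_inj]
  rw [eq_comm]

/-- The necklace letter recorded at position `i`. -/
def label (π : ColoredPerm N n) (s : Fin n → ℕ+) (i : Fin n) : BLetter N :=
  if i ∈ π.EXC then .barred (s i) else .unbarred (s i) (π.2 i)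

variable (π : ColoredPerm N n) (s : Fin n → ℕ+)

theorem label_abs (i : Fin n) : (label π s i).abs = s i := by
  unfold label
  split_ifs <;> rfl

theorem label_color (i : Fin n) : (label π s i).color = π.2 i := by
  unfold label
  split_ifs with h
  · exact (ColoredPerm.mem_EXC.1 h).1.symm
  · rfl

theorem label_isBarred (i : Fin n) : (label π s i).isBarred = true ↔ i ∈ π.EXC := by
  unfold label
  split_ifs with h <;> simp [BLetter.isBarred, h]

/-- The bottom rank of a barred letter plays the role of the tilde. -/
theorem tilde_le_tilde_iff (i j : Fin n) :
    π.tilde i ≤ π.tilde j ↔ (label π s i).rank < (label π s j).rank ∨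
      (label π s i).rank = (label π s j).rank ∧ π.1 i ≤ π.1 j := by
  unfold ColoredPerm.tilde label
  split_ifs <;>
    simp [BLetter.rank, ColoredPerm.letter, eLetter, Prod.Lex.toLex_le_toLex]

theorem toLex_label_le_iff (i j : Fin n) :
    (toLex (label π s i, π.1 i) : BLetter N ×ₗ Fin n) ≤ toLex (label π s j, π.1 j) ↔
      s j < s i ∨ s i = s j ∧ π.tilde i ≤ π.tilde j := by
  have heq : label π s i = label π s j ↔
      s i = s j ∧ (label π s i).rank = (label π s j).rank := by
    rw [← BLetter.key_injective.eq_iff]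
    simp [BLetter.key, label_abs]
  rw [Prod.Lex.toLex_le_toLex, tilde_le_tilde_iff π s, BLetter.lt_iff, label_abs, label_abs]
  simp only [heq]
  tauto

theorem monotone_of_le_next {α : Type*} [Preorder α] {f : Fin n → α}
    (h : ∀ (i : Fin n) (hi : (i : ℕ) + 1 < n), f i ≤ f ⟨i + 1, hi⟩) : Monotone f := by
  cases n with
  | zero => exact fun i => i.elim0
  | succ n => exact Fin.monotone_iff_le_succ.2 fun i => h i.castSucc (by simp)

theorem isCompatible_iff_isStandard :
    IsCompatible π.DEX s ↔ IsStandard π.1 (label π s) := by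
  constructor
  · rintro ⟨hs, hd⟩
    refine monotone_of_le_next fun i hi => ?_
    rw [toLex_label_le_iff]
    have hle : s ⟨i + 1, hi⟩ ≤ s i := hs (by simp [Fin.le_def])
    refine hle.lt_or_eq.imp id fun e => ⟨e.symm, ?_⟩
    by_contra! hlt
    exact (hd i ⟨hi, hlt⟩ hi).ne e
  · intro h
    have h' : ∀ i j, i ≤ j → s j < s i ∨ s i = s j ∧ π.tilde i ≤ π.tilde j :=
      fun i j hij => (toLex_label_le_iff π s i j).1 (h hij)
    refine ⟨fun i j hij => (h' i j hij).elim le_of_lt fun h => h.1.ge, ?_⟩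
    rintro i ⟨hi, hlt⟩ _
    exact (h' i ⟨i + 1, hi⟩ (by simp [Fin.le_def])).resolve_right fun h => not_le.2 hlt h.2

variable {π s}

/-- The necklace read off from the cycle containing `i`. -/
def necklaceOf (h : IsCompatible π.DEX s) (i : Fin n) : Necklace N :=
  ⟨periodCycle (walk π.1 (label π s) i), by
    have hstd := (isCompatible_iff_isStandard π s).1 h
    have hper := walk_mem_periodicPts π.1 (label π s) i
    refine ⟨isPrimitive_periodCycle hper, (chain_periodCycle_iff hper).2 fun k => ?_, fun u e => ?_⟩
    · simp only [walk, pow_succ', Equiv.Perm.mul_apply, NecklaceRule, label_abs, label_color]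
      rw [← Bool.not_eq_true, label_isBarred, ColoredPerm.mem_EXC]
      exact ⟨fun hb => h.1 hb.2.le, fun hb hc => h.1 (not_lt.1 fun hlt => hb ⟨hc, hlt⟩)⟩
    -- A one-letter barred necklace would come from a fixed point that is an excedance.
    · have hmin : minimalPeriod π.1 i = 1 := by
        rw [← hstd.minimalPeriod_walk, ← periodCycle_length, e]
        rfl
      have hmem : label π s i ∈ (periodCycle (walk π.1 (label π s) i)).toMultiset := by
        rw [hstd.toMultiset_periodCycle_walk]
        exact Multiset.mem_map_of_mem _ (mem_cycleSet.2 (Equiv.Perm.SameCycle.refl _ i))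
      rw [e, Cycle.coe_toMultiset, Multiset.mem_coe, List.mem_singleton] at hmem
      have hexc : i ∈ π.EXC := (label_isBarred π s i).1 (by rw [hmem]; rfl)
      exact (ColoredPerm.mem_EXC.1 hexc).2.ne' (minimalPeriod_eq_one_iff_isFixedPt.1 hmin)⟩

theorem toMultiset_necklaceOf (h : IsCompatible π.DEX s) (i : Fin n) :
    (necklaceOf h i).1.toMultiset = (cycleSet π.1 i).val.map (label π s) :=
  ((isCompatible_iff_isStandard π s).1 h).toMultiset_periodCycle_walk i

/-- The ornament of a colored permutation with a compatible sequence. -/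
def ornamentOf (h : IsCompatible π.DEX s) : Ornament N := orbitMultiset π.1 (necklaceOf h)

theorem map_val_ornamentOf (h : IsCompatible π.DEX s) :
    (ornamentOf h).map Subtype.val = cycleMultiset π.1 (label π s) :=
  map_orbitMultiset _ _ _

theorem countP_map_val {α β : Type*} (p : β → Prop) [DecidablePred p] (C : Finset α) (f : α → β)
    [DecidablePred fun i => p (f i)] :
    (C.val.map f).countP p = (C.filter fun i => p (f i)).card := by
  rw [Multiset.countP_map, Finset.card_def, Finset.filter_val]
  congr

theorem cvType_ornamentOf (h : IsCompatible π.DEX s) : (ornamentOf h).cvType = π.cvType := by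
  rw [ColoredPerm.cvType, cycleSets_val, map_orbitMultiset, Ornament.cvType, ornamentOf,
    map_orbitMultiset]
  congr 1
  funext i
  refine Prod.ext ?_ (funext fun m => ?_)
  · simp only [Necklace.cvPair]
    rw [← Cycle.card_toMultiset, toMultiset_necklaceOf, Multiset.card_map, Finset.card_def]
  · simp only [Necklace.cvPair]
    rw [toMultiset_necklaceOf, countP_map_val]
    simp only [label_color]

theorem numBarred_ornamentOf (h : IsCompatible π.DEX s) : (ornamentOf h).numBarred = π.exc := by
  rw [Ornament.numBarred, ornamentOf, map_orbitMultiset, ColoredPerm.exc,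
    ← Finset.filter_univ_mem π.EXC, Finset.card_filter, ← sum_orbitMultiset π.1]
  congr 2
  funext i
  rw [Necklace.numBarred, toMultiset_necklaceOf, countP_map_val, Finset.card_filter]
  simp only [label_isBarred]

theorem wt_ornamentOf (h : IsCompatible π.DEX s) :
    ((ornamentOf h).map Necklace.wt).prod = seqWeight s := by
  rw [seqWeight, ← prod_orbitMultiset π.1, ornamentOf, map_orbitMultiset]
  congr 2
  funext i
  rw [Necklace.wt, toMultiset_necklaceOf, Multiset.map_map]
  refine (congrArg Multiset.prod (Multiset.map_congr rfl fun k _ => ?_) :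
    _ = ((cycleSet π.1 i).val.map fun k => (MvPowerSeries.X (s k) : MvPowerSeries ℕ+ ℤ)).prod)
  rw [comp_apply, label_abs]

theorem eq_of_ornamentOf_eq {π' : ColoredPerm N n} {s' : Fin n → ℕ+} {h : IsCompatible π.DEX s}
    {h' : IsCompatible π'.DEX s'} (e : ornamentOf h = ornamentOf h') : π = π' ∧ s = s' := by
  have e' := congrArg (Multiset.map Subtype.val) e
  rw [map_val_ornamentOf, map_val_ornamentOf] at e'
  obtain ⟨h1, h2⟩ := ((isCompatible_iff_isStandard π s).1 h).eq_of_cycleMultiset_eq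
    ((isCompatible_iff_isStandard π' s').1 h') e'
  refine ⟨Prod.ext h1 (funext fun i => ?_), funext fun i => ?_⟩
  · rw [← label_color π s, h2, label_color]
  · rw [← label_abs π s, h2, label_abs]

theorem exists_ornamentOf_eq (R : Ornament N) (hn : (R.map fun v => v.1.length).sum = n) :
    ∃ (π : ColoredPerm N n) (s : Fin n → ℕ+) (h : IsCompatible π.DEX s), ornamentOf h = R := by
  have hR : ∀ c ∈ R.map (fun v : Necklace N => v.1), IsPrimitive c := by
    intro c hc
    obtain ⟨v, -, rfl⟩ := Multiset.mem_map.1 hc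
    exact v.2.1
  obtain ⟨σ, a, hstd, hcyc⟩ := exists_isStandard_of_isPrimitive (n := n) hR
    (by rw [Multiset.map_map]; exact hn)
  have hmem : ∀ i, ∃ v : Necklace N, v.1 = periodCycle (walk σ a i) := by
    intro i
    have := periodCycle_walk_mem_cycleMultiset σ a i
    rw [hcyc] at this
    obtain ⟨v, -, hv⟩ := Multiset.mem_map.1 this
    exact ⟨v, hv⟩
  have hrule : ∀ i k, NecklaceRule (walk σ a i k) (walk σ a i (k + 1)) := by
    intro i
    obtain ⟨v, hv⟩ := hmem i
    refine (chain_periodCycle_iff (walk_mem_periodicPts σ a i)).1 ?_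
    rw [← hv]
    exact v.2.2.1
  have hlt : ∀ i, (a i).isBarred = true → i < σ i := by
    intro i hb
    -- A constant walk with barred letter would give the circular word excluded by the third rule.
    have hne : shift (walk σ a i) ≠ walk σ a i := by
      intro e
      obtain ⟨v, hv⟩ := hmem i
      refine v.2.2.2 (a i).abs ?_
      have hmin : minimalPeriod shift (walk σ a i) = 1 := minimalPeriod_eq_one_iff_isFixedPt.2 e
      rw [hv, periodCycle, hmin]
      cases ha : a i with
      | unbarred => simp [ha, BLetter.isBarred] at hb
      | barred u => simp [walk, ha, BLetter.abs]
    have := lt_shift_of_isBarred (hrule i) hne hb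
    rw [shift_walk] at this
    exact hstd.monotone_walk.reflect_lt this
  have hle : ∀ i, (a i).isBarred = false → (a i).color = 0 → σ i ≤ i := by
    intro i hb hc
    -- A constant walk is allowed here; it comes from a fixed point, which is not an excedance.
    by_cases hne : shift (walk σ a i) = walk σ a i
    · rw [shift_walk] at hne
      exact (hstd.eq_of_walk_eq ⟨-1, by simp⟩ hne).le
    · have := shift_lt_of_color_eq_zero (hrule i) hne hb hc
      rw [shift_walk] at this
      exact (hstd.monotone_walk.reflect_lt this).le
  let π : ColoredPerm N n := (σ, fun i => (a i).color)
  have hlabel : label π (fun i => (a i).abs) = a := by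
    funext i
    refine BLetter.ext ?_ (label_abs _ _ i) (label_color _ _ i)
    rw [Bool.eq_iff_iff, label_isBarred, ColoredPerm.mem_EXC]
    constructor
    · rintro ⟨hc, hi⟩
      by_contra hb
      exact (hle i (by simpa using hb) hc).not_gt hi
    · intro hb
      refine ⟨?_, hlt i hb⟩
      change (a i).color = 0
      cases ha : a i with
      | unbarred => simp [ha, BLetter.isBarred] at hb
      | barred => rfl
  have hcomp : IsCompatible π.DEX fun i => (a i).abs := by
    rw [isCompatible_iff_isStandard, hlabel]
    exact hstd
  refine ⟨π, _, hcomp, Multiset.map_injective Subtype.val_injective ?_⟩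
  rw [map_val_ornamentOf, hlabel]
  exact hcyc

end Labels

/-! ### The bijection between compatible pairs and ornaments -/

section Bijection

variable {N : ℕ} [NeZero N] {lam : CvType N} {j : ℕ}

/-- The map from `Com(λ̌,j)` to `𝓡(λ̌,j)`. -/
def comToOrn (p : Com lam j) : Orn lam j :=
  ⟨ornamentOf p.2.2.2, (cvType_ornamentOf p.2.2.2).trans p.2.1,
    (numBarred_ornamentOf p.2.2.2).trans p.2.2.1⟩

theorem comToOrn_bijective : Bijective (comToOrn : Com lam j → Orn lam j) := by
  constructor
  · intro p q h
    obtain ⟨h1, h2⟩ := eq_of_ornamentOf_eq (congrArg Subtype.val h)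
    exact Subtype.ext (Prod.ext h1 h2)
  · rintro ⟨R, hcv, hbar⟩
    obtain ⟨π, s, h, rfl⟩ := exists_ornamentOf_eq (n := lam.size) R (by
      rw [← hcv, CvType.size, Ornament.cvType, Multiset.map_map]
      rfl)
    exact ⟨⟨(π, s), (cvType_ornamentOf h).symm.trans hcv, (numBarred_ornamentOf h).symm.trans hbar,
      h⟩, rfl⟩

theorem comToOrn_wt (p : Com lam j) : (comToOrn p).wt = p.wt := wt_ornamentOf p.2.2.2

end Bijection

/-! ## Summation -/

section Sums

/-- The exponent of the monomial of a sequence. -/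
def seqExponent {n : ℕ} (s : Fin n → ℕ+) : ℕ+ →₀ ℕ := ∑ i, Finsupp.single (s i) 1

theorem seqWeight_eq_monomial {n : ℕ} (s : Fin n → ℕ+) :
    seqWeight s = MvPowerSeries.monomial (seqExponent s) 1 := by
  classical
  rw [seqWeight, seqExponent]
  induction (Finset.univ : Finset (Fin n)) using Finset.induction_on with
  | empty => simp
  | insert i t hi ih =>
    rw [Finset.prod_insert hi, Finset.sum_insert hi, ih, MvPowerSeries.X,
      MvPowerSeries.monomial_mul_monomial, one_mul]

theorem finite_seqExponent_eq {n : ℕ} (d : ℕ+ →₀ ℕ) :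
    {s : Fin n → ℕ+ | seqExponent s = d}.Finite := by
  refine (Set.Finite.pi' fun _ : Fin n => d.support.finite_toSet).subset ?_
  rintro s rfl i
  have : Finsupp.single (s i) 1 (s i) ≤ seqExponent s (s i) := by
    rw [seqExponent, Finsupp.finsetSum_apply]
    exact Finset.single_le_sum (f := fun k => Finsupp.single (s k) 1 (s i))
      (fun _ _ => Nat.zero_le _) (Finset.mem_univ i)
  simp only [Finsupp.single_eq_same] at this
  simp only [Finset.mem_coe, Finsupp.mem_support_iff]
  omega

/-- Entries of a sequence with a given monomial lie in the support of its exponent, so a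
finite-to-one family contributes finitely many terms to each coefficient. -/
theorem summable_seqWeight {ι : Type*} {n : ℕ} (f : ι → Fin n → ℕ+)
    (hf : ∀ s, (f ⁻¹' {s}).Finite) : Summable fun i => seqWeight (f i) := by
  classical
  rw [MvPowerSeries.WithPiTopology.summable_iff_summable_coeff]
  intro d
  refine summable_of_hasFiniteSupport (((finite_seqExponent_eq d).preimage' fun s _ => hf s).subset ?_)
  intro i hi
  by_contra h
  refine hi ?_
  change MvPowerSeries.coeff d (seqWeight (f i)) = 0
  rw [seqWeight_eq_monomial, MvPowerSeries.coeff_monomial, if_neg fun e => h e.symm]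

variable {N : ℕ} [NeZero N] (lam : CvType N) (j : ℕ)

theorem hasSum_com : HasSum (fun p : Com lam j => p.wt) (Q lam j) := by
  classical
  let e : (Σ π : W lam j, {s : Fin lam.size → ℕ+ // IsCompatible π.1.DEX s}) ≃ Com lam j :=
    { toFun := fun x => ⟨(x.1.1, x.2.1), (Finset.mem_filter.1 x.1.2).2.1,
        (Finset.mem_filter.1 x.1.2).2.2, x.2.2⟩
      invFun := fun p => ⟨⟨p.1.1, Finset.mem_filter.2 ⟨Finset.mem_univ _, p.2.1, p.2.2.1⟩⟩,
        ⟨p.1.2, p.2.2.2⟩⟩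
      left_inv := fun _ => rfl
      right_inv := fun _ => rfl }
  have hsum : Summable fun p : Com lam j => p.wt := by
    refine summable_seqWeight (fun p : Com lam j => p.1.2) fun s => ?_
    -- Pairs with a fixed sequence are determined by their permutation, of which there are finitely
    -- many.
    refine Set.Finite.of_injOn (f := fun p : Com lam j => p.1.1) (t := Set.univ)
      (fun _ _ => Set.mem_univ _) ?_ Set.finite_univ
    rintro p hp q hq h
    exact Subtype.ext (Prod.ext h (hp.trans hq.symm))
  have hfib : ∀ π : W lam j, HasSum
      (fun s : {s : Fin lam.size → ℕ+ // IsCompatible π.1.DEX s} => seqWeight s.1)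
      (fundamentalQSym π.1.DEX) := by
    intro π
    refine (summable_seqWeight (fun s : {s : Fin lam.size → ℕ+ // IsCompatible π.1.DEX s} => s.1)
      fun s => ?_).hasSum
    exact (Set.finite_singleton s).preimage Subtype.val_injective.injOn
  have htot := (e.hasSum_iff.2 hsum.hasSum).sigma hfib
  have hQ : ∑' p : Com lam j, p.wt = Q lam j := by
    rw [htot.unique (hasSum_fintype _), Q]
    exact Finset.sum_coe_sort (W lam j) fun π => fundamentalQSym π.DEX
  exact hQ ▸ hsum.hasSum

end Sums

end

end ColoredEulerian

theorem theorem3p2 (N : ℕ) [NeZero N] (lam : ColoredEulerian.CvType N) (j : ℕ) :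
    (∃ f : ColoredEulerian.Com lam j → ColoredEulerian.Orn lam j,
      Function.Bijective f ∧ ∀ p : ColoredEulerian.Com lam j, (f p).wt = p.wt) ∧
    HasSum (fun p : ColoredEulerian.Com lam j => p.wt) (ColoredEulerian.Q lam j) ∧
    HasSum (fun R : ColoredEulerian.Orn lam j => R.wt) (ColoredEulerian.Q lam j) := by
  have hsum := ColoredEulerian.hasSum_com lam j
  refine ⟨⟨_, ColoredEulerian.comToOrn_bijective, ColoredEulerian.comToOrn_wt⟩, hsum, ?_⟩
  rw [← (Equiv.ofBijective _ (ColoredEulerian.comToOrn_bijective (lam := lam) (j := j))).hasSum_iff]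
  convert hsum using 1
  funext p
  exact ColoredEulerian.comToOrn_wt p
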